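/- A structural causal model (SCM) $\mathcal M=\langle \mathbf U,\mathbf V,\mathcal F,P(\mathbf U)\rangle$ consists of exogenous variables $\mathbf U$, finitely many endogenous variables $\mathbf V$, each variable having a range (standard Borel for endogenous variables), a measurable mechanism $V=f_V(Pa(V),\mathbf U_V)$ for every $V\in\mathbf V$, where $Pa(V)\subseteq\mathbf V$, $\mathbf U_V\subseteq\mathbf U$, and a probability distribution $P(\mathbf U)$. Its graph has an edge $V_i\to V_j$ if $V_i\in Pa(V_j)$, and a confounding edge $V_i\leftrightarrow V_j$ if $V_i\neq V_j$ share an exogenous parent; the directed part is acyclic. Write $do(\mathbf Z)$ for hard interventions. An SCM is called (interventionally) faithful if for all pairwise disjoint $\mathbf X,\mathbf Y,\mathbf Z\subseteq\mathbf V$ each of the following relations, understood for all values of the intervened variables, holds if and only if $\mathbf X$ and $\mathbf Y$ are d-separated given $\mathbf Z$ in the indicated mutilation of its DAG $G$ on $\mathbf U\cup\mathbf V$ (a bar over $G$'s index set deletes the edges into that set, a bar under it the edges out of it): (i) $P(\mathbf Y\mid \mathbf X,do(\mathbf Z))=P(\mathbf Y\mid do(\mathbf Z))$, in $G_{\overline{\mathbf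 Z}}$; (ii) $P(\mathbf Y\mid \mathbf X,do(\mathbf Z))=P(\mathbf Y\mid do(\mathbf X),do(\mathbf Z))$, in $G_{\overline{\mathbf Z}\,\underline{\mathbf X}}$; (iii) $P(\mathbf Y\mid do(\mathbf X),do(\mathbf Z))=P(\mathbf Y\mid do(\mathbf Z))$, in $G_{\overline{\mathbf X\cup\mathbf Z}}$. An $\alpha$-abstraction $\boldsymbol\alpha:\mathcal M\to\mathcal M'$ is a triple $\langle\mathbf R,\varphi,\alpha\rangle$ with $\mathbf R\subseteq\mathbf V_{\mathcal M}$ (possibly a proper subset), a surjection $\varphi:\mathbf R\to\mathbf V_{\mathcal M'}$, and for each $V'\in \mathbf V_{\mathcal M'}$ a measurable surjection $\alpha_{V'}$ from the joint range of $\varphi^{-1}(V')$ onto the range of $V'$. It is bijective if all $\alpha_{V'}$ are bijective. For $\mathbf Y\subseteq\mathbf V_{\mathcal M'}$ let $\alpha_{\mathbf Y}=(\alpha_{V'})_{V'\in\mathbf Y}$. The abstraction is $\mathcal L_2$-consistent if for all $\mathbf X,\mathbf Y\subseteq\mathbf V_{\mathcal M'}$ and all values $x$ of $\varphi^{-1}(\mathbf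 X)$, $$P_{\mathcal M'}\bigl(\mathbf Y\mid do(\mathbf X=\alpha_{\mathbf X}(x))\bigr)=(\alpha_{\mathbf Y})_{\#}\,P_{\mathcal M}\bigl(\varphi^{-1}(\mathbf Y)\mid do(\varphi^{-1}(\mathbf X)=x)\bigr).$$ **Theorem.** Let $\mathcal M,\mathcal M'$ be faithful SCMs and $\boldsymbol\alpha=\langle\mathbf R,\varphi,\alpha\rangle:\mathcal M\to\mathcal M'$ a bijective $\mathcal L_2$-consistent $\alpha$-abstraction. Then the graph of $\mathcal M'$ is the Partial Cluster DAG of the graph of $\mathcal M$ with respect to the clustering $\varphi$, with remainder set $\mathbf Q=\mathbf V_{\mathcal M}\setminus\mathbf R$. That is, the directed part of the graph of $\mathcal M'$ is acyclic, and, writing clusters $\mathbf C_i$ both for variables of $\mathcal M'$ and for their pre-images under $\varphi$, for all $\mathbf C_i,\mathbf C_j$: * (Rule 1) $\mathbf C_i\to\mathbf C_j$ if and only if $\mathbf C_i\ne\mathbf C_j$ and there are $V_i\in\mathbf C_i$, $V_j\in\mathbf C_j$ and a directed path $V_i\to\dots\to V_j$ in $\mathcal M$ all of whose intermediate variables are in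 $\mathbf Q$ (a mediated adjacency); * (Rules 2A, 2B) $\mathbf C_i\leftrightarrow\mathbf C_j$ if and only if $\mathbf C_i\neq\mathbf C_j$ and there are $V_i\in\mathbf C_i$, $V_j\in\mathbf C_j$ such that (2A) there is $V_i\leftarrow\dots\leftrightarrow\dots\to V_j$ with zero or more intermediate variables on either side, all in $\mathbf Q$, or (2B) there is a $Q\in\mathbf Q$ with directed paths $V_i\leftarrow\dots\leftarrow Q\to\dots\to V_j$ all of whose intermediate variables are in $\mathbf Q$. -/

import Mathlib

open MeasureTheory ProbabilityTheory

/-- A structural causal model with endogenous variables `V` (with ranges `D v`) and exogenous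
variables `U` (with ranges `E e`). The mechanism of `v` takes as arguments its endogenous parents
`pa v` and its exogenous parents `exo v`; the direct causes of `v` are the variables in this
signature. No independence of the exogenous variables is built in. There are no cyclic causal
relations. -/
structure SCM (V U : Type*) (D : V → Type*) (E : U → Type*)
    [∀ v, MeasurableSpace (D v)] [∀ e, MeasurableSpace (E e)] where
  pa : V → Set V
  exo : V → Set U
  mech : ∀ v, (∀ p : pa v, D p) → (∀ e : exo v, E e) → D v
  measurable_mech : ∀ v, Measurable
    (fun q : (∀ p : pa v, D p) × (∀ e : exo v, E e) => mech v q.1 q.2)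
  prob : Measure (∀ e, E e)
  isProbabilityMeasure_prob : IsProbabilityMeasure prob
  acyclic : ∀ v, ¬ Relation.TransGen (fun a b => a ∈ pa b) v v

/-- A graph with directed edges `dir a b` (read `a → b`) and confounding (bidirected)
edges `conf a b`. -/
structure CausalGraph (V : Type*) where
  dir : V → V → Prop
  conf : V → V → Prop

/-! ### d-separation -/

/-- The sequence `p 0, …, p n` is a path in the directed graph `r` that is active given `S`:
its vertices are distinct, consecutive ones are adjacent, every collider on it has a descendant
(possibly itself) in `S`, and no inner non-collider is in `S`. -/
def IsActivePath {N : Type*} (r : N → N → Prop) (S : Set N) (n : ℕ) (p : ℕ → N) : Prop :=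
  (∀ i j, i ≤ n → j ≤ n → p i = p j → i = j) ∧
  (∀ i, i + 1 ≤ n → r (p i) (p (i + 1)) ∨ r (p (i + 1)) (p i)) ∧
  (∀ i, i + 2 ≤ n →
    ((r (p i) (p (i + 1)) ∧ r (p (i + 2)) (p (i + 1))) →
      ∃ s ∈ S, Relation.ReflTransGen r (p (i + 1)) s) ∧
    (¬ (r (p i) (p (i + 1)) ∧ r (p (i + 2)) (p (i + 1))) → p (i + 1) ∉ S))

/-- `X` and `Y` are d-separated given `S` in the directed graph `r`. -/
def DSep {N : Type*} (r : N → N → Prop) (X Y S : Set N) : Prop :=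
  ∀ (n : ℕ) (p : ℕ → N), p 0 ∈ X → p n ∈ Y → ¬ IsActivePath r S n p

namespace SCM

variable {V U : Type*} {D : V → Type*} {E : U → Type*}
  [∀ v, MeasurableSpace (D v)] [∀ e, MeasurableSpace (E e)]

theorem wellFounded_pa [Finite V] (M : SCM V U D E) :
    WellFounded (fun a b : V => a ∈ M.pa b) := by
  have h : WellFounded (Relation.TransGen (fun a b : V => a ∈ M.pa b)) := by
    have : Std.Irrefl (Relation.TransGen (fun a b : V => a ∈ M.pa b)) := ⟨M.acyclic⟩
    exact Finite.wellFounded_of_trans_of_irrefl _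
  exact Subrelation.wf
    (q := fun a b : V => a ∈ M.pa b) (r := Relation.TransGen (fun a b : V => a ∈ M.pa b))
    (fun hab => Relation.TransGen.single hab) h

open Classical in
/-- The values of the endogenous variables in the model with the intervention `do(Z = a)`
(only the values of `a` on `Z` matter), when the exogenous variables take the value `u`. -/
noncomputable def solve [Finite V] (M : SCM V U D E) (Z : Set V) (a : ∀ v, D v)
    (u : ∀ e, E e) : ∀ v, D v :=
  M.wellFounded_pa.fix (fun v rec =>
    if v ∈ Z then a v else M.mech v (fun p => rec p.1 p.2) (fun e => u e.1))

open Classical in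
theorem solve_eq [Finite V] (M : SCM V U D E) (Z : Set V) (a : ∀ v, D v)
    (u : ∀ e, E e) (v : V) :
    M.solve Z a u v =
      if v ∈ Z then a v else M.mech v (fun p => M.solve Z a u p.1) (fun e => u e.1) := by
  unfold solve
  rw [WellFounded.fix_eq]

/-- The joint distribution `P(V | do(Z = a))` of all endogenous variables. -/
noncomputable def doLaw [Finite V] (M : SCM V U D E) (Z : Set V) (a : ∀ v, D v) :
    Measure (∀ v, D v) :=
  M.prob.map (M.solve Z a)

/-- The interventional distribution `P(Y | do(Z = a))` of the variables in `Y`. -/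
noncomputable def doDist [Finite V] (M : SCM V U D E) (Z : Set V) (a : ∀ v, D v) (Y : Set V) :
    Measure (∀ v : Y, D v) :=
  (M.doLaw Z a).map Y.domRestrict

/-- The graph of an SCM: an edge `a → b` if `a` is a direct cause of `b`, and a confounding edge
between two different variables if they share an exogenous parent. -/
def graph (M : SCM V U D E) : CausalGraph V where
  dir a b := a ∈ M.pa b
  conf a b := a ≠ b ∧ ∃ e, e ∈ M.exo a ∧ e ∈ M.exo b

/-- The DAG of an SCM with its exogenous variables as vertices, after deleting all edges into
variables in `A` and all edges out of variables in `B`. -/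
def mutilatedEdge (M : SCM V U D E) (A B : Set V) : U ⊕ V → U ⊕ V → Prop
  | Sum.inl e, Sum.inr v => e ∈ M.exo v ∧ v ∉ A
  | Sum.inr w, Sum.inr v => w ∈ M.pa v ∧ v ∉ A ∧ w ∉ B
  | _, Sum.inl _ => False

/-- d-separation of sets `X`, `Y` of endogenous variables given `Z` in a mutilated DAG. -/
def MutilatedDSep (M : SCM V U D E) (A B X Y Z : Set V) : Prop :=
  DSep (M.mutilatedEdge A B) (Sum.inr '' X) (Sum.inr '' Y) (Sum.inr '' Z)

/-- `X` and `Y` are independent under every intervention on `Z`: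
`P(Y | X, do(Z)) = P(Y | do(Z))`. -/
def IndepUnderDo [Finite V] (M : SCM V U D E) (X Y Z : Set V) : Prop :=
  ∀ a : ∀ v, D v, IndepFun (X.domRestrict (π := D)) (Y.domRestrict (π := D)) (M.doLaw Z a)

/-- `P(Y | X, do(Z)) = P(Y | do(X), do(Z))`: for every value of `Z`, the conditional distribution
of `Y` given `X = x` under `do(Z)` is, for almost all `x`, the distribution of `Y` under
`do(X = x), do(Z)`. (Under `do(Z = a)` the random assignment `w` agrees with `a` on `Z`.) -/
def SeeingEqDoing [Finite V] (M : SCM V U D E) (X Y Z : Set V) : Prop :=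
  ∀ a : ∀ v, D v, ∀ (A : Set (∀ v : X, D v)) (B : Set (∀ v : Y, D v)),
    MeasurableSet A → MeasurableSet B →
    M.doLaw Z a (X.domRestrict ⁻¹' A ∩ Y.domRestrict ⁻¹' B) =
      ∫⁻ w in X.domRestrict ⁻¹' A, M.doDist (X ∪ Z) w Y B ∂(M.doLaw Z a)

/-- `P(Y | do(X), do(Z)) = P(Y | do(Z))`, for all values of `X` and `Z`. -/
def NoEffect [Finite V] (M : SCM V U D E) (X Y Z : Set V) : Prop :=
  ∀ a : ∀ v, D v, M.doDist (X ∪ Z) a Y = M.doDist Z a Y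

/-- Faithfulness on the interventional layer: for disjoint sets `X, Y, Z` of endogenous variables
and each of the three kinds of (in)dependence relations of the do-calculus, the relation holds
in the model if and only if the corresponding d-separation holds in the correspondingly
mutilated DAG. -/
structure IsFaithful [Finite V] (M : SCM V U D E) : Prop where
  indep_iff : ∀ X Y Z : Set V, Disjoint X Y → Disjoint X Z → Disjoint Y Z →
    (M.IndepUnderDo X Y Z ↔ M.MutilatedDSep Z ∅ X Y Z)
  seeing_iff : ∀ X Y Z : Set V, Disjoint X Y → Disjoint X Z → Disjoint Y Z →
    (M.SeeingEqDoing X Y Z ↔ M.MutilatedDSep Z X X Y Z)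
  effect_iff : ∀ X Y Z : Set V, Disjoint X Y → Disjoint X Z → Disjoint Y Z →
    (M.NoEffect X Y Z ↔ M.MutilatedDSep (X ∪ Z) ∅ X Y Z)

end SCM

/-! ### α-abstractions -/

/-- The pre-image in `V` of a set `Y` of abstract variables under `φ : R → C`, `R ⊆ V`. -/
def varPreimage {V C : Type*} {R : Set V} (φ : R → C) (Y : Set C) : Set V :=
  {v | ∃ h : v ∈ R, φ ⟨v, h⟩ ∈ Y}

theorem varPreimage_mono {V C : Type*} {R : Set V} (φ : R → C) {Y₁ Y₂ : Set C} (h : Y₁ ⊆ Y₂) :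
    varPreimage φ Y₁ ⊆ varPreimage φ Y₂ :=
  fun _ hv => ⟨hv.1, h hv.2⟩

/-- An α-abstraction `⟨R, φ, α⟩` from variables `V` with ranges `D` to variables `C` with
ranges `D'`. -/
structure AlphaAbstraction {V C : Type*} (D : V → Type*) (D' : C → Type*)
    [∀ v, MeasurableSpace (D v)] [∀ c, MeasurableSpace (D' c)] where
  R : Set V
  φ : R → C
  φ_surjective : Function.Surjective φ
  val : ∀ c : C, (∀ v : varPreimage φ {c}, D v) → D' c
  val_measurable : ∀ c, Measurable (val c)
  val_surjective : ∀ c, Function.Surjective (val c)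

namespace AlphaAbstraction

variable {V C : Type*} {D : V → Type*} {D' : C → Type*}
  [∀ v, MeasurableSpace (D v)] [∀ c, MeasurableSpace (D' c)]

/-- The range maps are bijective. -/
def IsBijective (α : AlphaAbstraction D D') : Prop :=
  ∀ c, Function.Bijective (α.val c)

/-- The map `α_Y` from the range of `φ⁻¹(Y)` to the range of `Y`. -/
def mapOn (α : AlphaAbstraction D D') (Y : Set C) (w : ∀ v : varPreimage α.φ Y, D v) :
    ∀ c : Y, D' c :=
  fun c => α.val c (fun v =>
    w ⟨v.1, varPreimage_mono α.φ (Set.singleton_subset_iff.2 c.2) v.2⟩)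

/-- The maps `α_c` for all abstract variables `c` together, on full assignments. -/
def mapAll (α : AlphaAbstraction D D') (a : ∀ v, D v) : ∀ c, D' c :=
  fun c => α.val c (fun v => a v.1)

/-- Functional consistency on the interventional layer: for all `X, Y ⊆ C` and all values `x` of
`φ⁻¹(X)`, the distribution `P(Y | do(X = α_X(x)))` of the abstract model is the push-forward
under `α_Y` of the distribution `P(φ⁻¹(Y) | do(φ⁻¹(X) = x))` of the base model. -/
def IsL2Consistent [Finite V] [Finite C] {U U' : Type*} {E : U → Type*} {E' : U' → Type*}
    [∀ e, MeasurableSpace (E e)] [∀ e, MeasurableSpace (E' e)]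
    (α : AlphaAbstraction D D') (M : SCM V U D E) (M' : SCM C U' D' E') : Prop :=
  ∀ (X Y : Set C) (a : ∀ v, D v),
    M'.doDist X (α.mapAll a) Y =
      (M.doDist (varPreimage α.φ X) a (varPreimage α.φ Y)).map (α.mapOn Y)

end AlphaAbstraction

/-! ### Partial cluster DAGs -/

/-- There is a directed path `a → … → b` (with at least one edge) all of whose intermediate
vertices are in `Rem`. -/
inductive MediatedAdj {V : Type*} (r : V → V → Prop) (Rem : Set V) : V → V → Prop
  | edge {a b : V} : r a b → MediatedAdj r Rem a b
  | cons {a q b : V} : r a q → q ∈ Rem → MediatedAdj r Rem q b → MediatedAdj r Rem a b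

namespace CausalGraph

variable {V : Type*}

/-- `a ← … ↔ … → b` with zero or more intermediate vertices on either side, all in `Rem`. -/
def ConfPath (G : CausalGraph V) (Rem : Set V) (a b : V) : Prop :=
  ∃ s t, G.conf s t ∧
    (s = a ∨ (s ∈ Rem ∧ MediatedAdj G.dir Rem s a)) ∧
    (t = b ∨ (t ∈ Rem ∧ MediatedAdj G.dir Rem t b))

/-- `a ← … ← Q → … → b` for some `Q ∈ Rem`, with all intermediate vertices in `Rem`. -/
def RemainderFork (G : CausalGraph V) (Rem : Set V) (a b : V) : Prop :=
  ∃ Q ∈ Rem, MediatedAdj G.dir Rem Q a ∧ MediatedAdj G.dir Rem Q b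

/-- `H` is the partial cluster DAG of `G` for the clustering `φ : R → C` (a surjection; the
remainder set is the complement of `R`). The three clauses on edges are, in order, Rule 1 for
directed edges, Rules 2A and 2B for confounding edges, and acyclicity; edges exist exactly when
a rule produces them. -/
structure IsPartialClusterDAG {C : Type*} (G : CausalGraph V) (R : Set V) (φ : R → C)
    (H : CausalGraph C) : Prop where
  surjective : Function.Surjective φ
  dir_iff : ∀ i j : C, H.dir i j ↔ i ≠ j ∧
    ∃ a b : R, φ a = i ∧ φ b = j ∧ MediatedAdj G.dir Rᶜ a b
  conf_iff : ∀ i j : C, H.conf i j ↔ i ≠ j ∧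
    ∃ a b : R, φ a = i ∧ φ b = j ∧ (G.ConfPath Rᶜ a b ∨ G.RemainderFork Rᶜ a b)
  acyclic : ∀ i, ¬ Relation.TransGen H.dir i i

end CausalGraph

/-!
Fix two abstract variables `i ≠ j`, let `X` and `Y` be their clusters, and let `Z` be the union of
all other clusters. When the edges into `Z` are deleted, no path that is active given `Z` can have a
collider, so d-connection of `X` and `Y` given `Z` means that some `a ∈ X` and `b ∈ Y` have a common
ancestor outside `Z` (`not_dSep_iff_exists_common_ancestor`). Cutting the two directed paths from
this ancestor at suitable vertices of `X` and `Y` leaves only remainder variables in between, and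
gives two criteria:

* with the edges into `X` deleted as well, `X` and `Y` are d-connected iff there is a mediated
  adjacency from `X` to `Y` (`SCM.not_mutilatedDSep_effect_iff`);
* with the edges out of `X` deleted, they are d-connected iff Rule 2A or Rule 2B applies to `X` and
  `Y`, or there is a mediated adjacency from `Y` to `X` (`SCM.not_mutilatedDSep_seeing_iff`).

For singletons and an empty remainder these criteria detect the edge `i → j`, respectively a
confounding edge or the edge `j → i`. By faithfulness they are equivalent to failure of
`P(Y | do(X), do(Z)) = P(Y | do(Z))` and of `P(Y | X, do(Z)) = P(Y | do(X), do(Z))`. Both relations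
hold in the abstract model iff they hold for the clusters in the base model
(`AlphaAbstraction.IsL2Consistent.noEffect_iff` and
`AlphaAbstraction.IsL2Consistent.seeingEqDoing_iff`), because the bijective measurable maps `α_Y`
between standard Borel spaces are measurable embeddings, and push-forward along them loses no
information. Since the abstract graph is acyclic, at least one of `j → i` and `i → j` is absent, and
the second criterion, read in the right order, decides the confounding edge.
-/

/-! ### d-separation given a set without incoming edges -/

section Treks

variable {N : Type*} {r : N → N → Prop} {S : Set N}

theorem not_reflTransGen_of_no_edge_into (hS : ∀ x, ∀ s ∈ S, ¬ r x s) {x y s : N} (hxy : r x y)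
    (hs : s ∈ S) : ¬ Relation.ReflTransGen r y s := by
  intro h
  rcases Relation.ReflTransGen.cases_tail h with rfl | ⟨c, -, hc⟩
  · exact hS _ _ hs hxy
  · exact hS _ _ hs hc

/-- A path without colliders is directed backwards up to some vertex and forwards from there on, so
its two ends have a common ancestor on it. The second alternative records that the last edge points
forwards, so that an edge pointing backwards after it would make a collider. -/
theorem exists_common_ancestor_of_no_collider {n : ℕ} {p : ℕ → N}
    (hadj : ∀ i, i + 1 ≤ n → r (p i) (p (i + 1)) ∨ r (p (i + 1)) (p i))
    (hcol : ∀ i, i + 2 ≤ n → ¬ (r (p i) (p (i + 1)) ∧ r (p (i + 2)) (p (i + 1)))) :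
    Relation.ReflTransGen r (p n) (p 0) ∨
      ∃ k ≤ n, Relation.ReflTransGen r (p k) (p 0) ∧ Relation.ReflTransGen r (p k) (p n) ∧
        ∃ m, m + 1 = n ∧ r (p m) (p (m + 1)) := by
  induction n with
  | zero => exact Or.inl .refl
  | succ n ih =>
    have ih := ih (fun i hi => hadj i (by omega)) (fun i hi => hcol i (by omega))
    rcases hadj n le_rfl with hf | hb
    · right
      rcases ih with h | ⟨k, hk, h0, hn, -⟩
      · exact ⟨n, by omega, h, .single hf, n, rfl, hf⟩
      · exact ⟨k, by omega, h0, hn.tail hf, n, rfl, hf⟩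
    · left
      rcases ih with h | ⟨k, hk, h0, hn, m, rfl, hm⟩
      · exact .head hb h
      · exact absurd ⟨hm, hb⟩ (hcol m le_rfl)

theorem exists_walk_of_reflTransGen {x y : N} (h : Relation.ReflTransGen r x y) :
    ∃ (n : ℕ) (f : ℕ → N), f 0 = x ∧ f n = y ∧ ∀ i < n, r (f i) (f (i + 1)) := by
  induction h using Relation.ReflTransGen.head_induction_on with
  | refl => exact ⟨0, fun _ => y, rfl, rfl, by simp⟩
  | @head a c hac _ ih =>
    obtain ⟨n, f, h0, hn, hf⟩ := ih
    refine ⟨n + 1, fun i => Nat.casesOn i a f, rfl, hn, ?_⟩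
    rintro (_ | i) hi
    · simpa [h0] using hac
    · exact hf i (by omega)

theorem transGen_of_walk {n : ℕ} {f : ℕ → N} (hf : ∀ i < n, r (f i) (f (i + 1))) {i j : ℕ}
    (hij : i < j) (hj : j ≤ n) : Relation.TransGen r (f i) (f j) := by
  induction j, hij using Nat.le_induction with
  | base => exact .single (hf i (by omega))
  | succ j hij ih => exact (ih (by omega)).tail (hf j (by omega))

/-- Two directed walks of minimal total length from a common start meet only in that start, hence
form a path without colliders. -/
theorem exists_isActivePath_of_common_ancestor (hac : ∀ x, ¬ Relation.TransGen r x x)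
    (hS : ∀ x, ∀ s ∈ S, ¬ r x s) {t a b : N} (ht : t ∉ S)
    (hta : Relation.ReflTransGen r t a) (htb : Relation.ReflTransGen r t b) :
    ∃ (n : ℕ) (p : ℕ → N), p 0 = a ∧ p n = b ∧ IsActivePath r S n p := by
  classical
  have hex : ∃ n k l : ℕ, k + l = n ∧ ∃ f g : ℕ → N, f 0 ∉ S ∧ f 0 = g 0 ∧ f k = a ∧ g l = b ∧
      (∀ i < k, r (f i) (f (i + 1))) ∧ ∀ i < l, r (g i) (g (i + 1)) := by
    obtain ⟨k, f, hf0, hfk, hf⟩ := exists_walk_of_reflTransGen hta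
    obtain ⟨l, g, hg0, hgl, hg⟩ := exists_walk_of_reflTransGen htb
    exact ⟨_, k, l, rfl, f, g, hf0 ▸ ht, hf0.trans hg0.symm, hfk, hgl, hf, hg⟩
  obtain ⟨k, l, hkl, f, g, h0, hfg, hfk, hgl, hf, hg⟩ := Nat.find_spec hex
  have hmin : ∀ m < k + l, _ := fun m hm => Nat.find_min hex (m := m) (by omega)
  have hfS : ∀ i ≤ k, f i ∉ S := by
    rintro (_ | i) hi
    · exact h0
    · exact fun h => hS _ _ h (hf i (by omega))
  have hgS : ∀ i ≤ l, g i ∉ S := by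
    rintro (_ | i) hi
    · exact hfg ▸ h0
    · exact fun h => hS _ _ h (hg i (by omega))
  have hasymm : ∀ x y, r x y → ¬ r y x := fun x y h h' => hac x (.head h (.single h'))
  have hff : ∀ i j, i ≤ k → j ≤ k → f i = f j → i = j := by
    intro i j hi hj h
    rcases lt_trichotomy i j with hlt | rfl | hlt
    · exact absurd (h ▸ transGen_of_walk hf hlt hj) (hac _)
    · rfl
    · exact absurd (h ▸ transGen_of_walk hf hlt hi) (hac _)
  have hgg : ∀ i j, i ≤ l → j ≤ l → g i = g j → i = j := by
    intro i j hi hj h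
    rcases lt_trichotomy i j with hlt | rfl | hlt
    · exact absurd (h ▸ transGen_of_walk hg hlt hj) (hac _)
    · rfl
    · exact absurd (h ▸ transGen_of_walk hg hlt hi) (hac _)
  -- A second meeting point would be the start of a shorter pair of walks.
  have hfgne : ∀ i j, i ≤ k → j ≤ l → 0 < j → f i ≠ g j := by
    intro i j hi hj hpos h
    refine hmin ((k - i) + (l - j)) (by omega) ⟨k - i, l - j, rfl, fun m => f (i + m),
      fun m => g (j + m), hfS i hi, h, ?_, ?_, fun m hm => hf (i + m) (by omega),
      fun m hm => hg (j + m) (by omega)⟩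
    · show f (i + (k - i)) = a
      rw [Nat.add_sub_cancel' hi, hfk]
    · show g (j + (l - j)) = b
      rw [Nat.add_sub_cancel' hj, hgl]
  let p : ℕ → N := fun i => if i ≤ k then f (k - i) else g (i - k)
  have hpl : ∀ i, i ≤ k → p i = f (k - i) := fun i hi => if_pos hi
  have hpr : ∀ i, k ≤ i → p i = g (i - k) := by
    intro i hi
    rcases hi.eq_or_lt with rfl | hlt
    · simp [p, hfg]
    · exact if_neg (by omega)
  have hpS : ∀ i, i ≤ k + l → p i ∉ S := by
    intro i hi
    rcases le_total i k with h | h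
    · rw [hpl i h]; exact hfS _ (by omega)
    · rw [hpr i h]; exact hgS _ (by omega)
  have hback : ∀ i, i < k → r (p (i + 1)) (p i) := by
    intro i hi
    rw [hpl i (by omega), hpl (i + 1) (by omega)]
    have := hf (k - (i + 1)) (by omega)
    rwa [show k - (i + 1) + 1 = k - i by omega] at this
  have hforw : ∀ i, k ≤ i → i < k + l → r (p i) (p (i + 1)) := by
    intro i hi hi'
    rw [hpr i hi, hpr (i + 1) (by omega)]
    have := hg (i - k) (by omega)
    rwa [show i - k + 1 = i + 1 - k by omega] at this
  refine ⟨k + l, p, by rw [hpl 0 (Nat.zero_le _)]; simpa using hfk,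
    by rw [hpr _ (by omega)]; simpa using hgl, ?_, ?_, ?_⟩
  · intro i j hi hj h
    rcases le_or_gt i k with hik | hik <;> rcases le_or_gt j k with hjk | hjk
    · rw [hpl i hik, hpl j hjk] at h
      have := hff _ _ (by omega) (by omega) h
      omega
    · rw [hpl i hik, hpr j hjk.le] at h
      exact absurd h (hfgne _ _ (by omega) (by omega) (by omega))
    · rw [hpr i hik.le, hpl j hjk] at h
      exact absurd h.symm (hfgne _ _ (by omega) (by omega) (by omega))
    · rw [hpr i hik.le, hpr j hjk.le] at h
      have := hgg _ _ (by omega) (by omega) h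
      omega
  · intro i hi
    rcases lt_or_ge i k with h | h
    · exact Or.inr (hback i h)
    · exact Or.inl (hforw i h (by omega))
  · intro i hi
    refine ⟨fun ⟨h1, h2⟩ => ?_, fun _ => hpS _ (by omega)⟩
    rcases lt_or_ge i k with h | h
    · exact absurd h1 (hasymm _ _ (hback i h))
    · exact absurd h2 (hasymm _ _ (hforw (i + 1) (by omega) (by omega)))

/-- If no edge points into the conditioning set `S`, then no path that is active given `S` has a
collider, so d-connection means having a common ancestor outside `S`. -/
theorem not_dSep_iff_exists_common_ancestor (hac : ∀ x, ¬ Relation.TransGen r x x)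
    (hS : ∀ x, ∀ s ∈ S, ¬ r x s) {X Y : Set N} (hXS : Disjoint X S) (hYS : Disjoint Y S) :
    ¬ DSep r X Y S ↔ ∃ t ∉ S, ∃ a ∈ X, ∃ b ∈ Y,
      Relation.ReflTransGen r t a ∧ Relation.ReflTransGen r t b := by
  constructor
  · intro h
    simp only [DSep, not_forall, not_not] at h
    obtain ⟨n, p, hp0, hpn, -, hadj, hin⟩ := h
    have hcol : ∀ i, i + 2 ≤ n → ¬ (r (p i) (p (i + 1)) ∧ r (p (i + 2)) (p (i + 1))) := by
      intro i hi hc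
      obtain ⟨s, hs, hps⟩ := (hin i hi).1 hc
      exact not_reflTransGen_of_no_edge_into hS hc.1 hs hps
    have hpS : ∀ i ≤ n, p i ∉ S := by
      intro i hi
      rcases i with _ | i
      · exact Set.disjoint_left.1 hXS hp0
      · rcases hi.eq_or_lt with rfl | hlt
        · exact Set.disjoint_left.1 hYS hpn
        · exact (hin i (by omega)).2 (hcol i (by omega))
    rcases exists_common_ancestor_of_no_collider hadj hcol with h | ⟨k, hk, h0, hn, -⟩
    · exact ⟨p n, hpS n le_rfl, p 0, hp0, p n, hpn, h, .refl⟩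
    · exact ⟨p k, hpS k hk, p 0, hp0, p n, hpn, h0, hn⟩
  · rintro ⟨t, ht, a, ha, b, hb, hta, htb⟩ h
    obtain ⟨n, p, rfl, rfl, hp⟩ := exists_isActivePath_of_common_ancestor hac hS ht hta htb
    exact h n p ha hb hp

end Treks

/-! ### Mediated adjacencies and directed paths in mutilated graphs -/

namespace SCM

section Mutilated

variable {V U : Type*} {D : V → Type*} {E : U → Type*}
  [∀ v, MeasurableSpace (D v)] [∀ e, MeasurableSpace (E e)] (M : SCM V U D E) {A B : Set V}

theorem not_mutilatedEdge_inl (x : U ⊕ V) (e : U) : ¬ M.mutilatedEdge A B x (Sum.inl e) := by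
  rcases x with x | x <;> exact id

theorem mutilatedEdge_acyclic (x : U ⊕ V) :
    ¬ Relation.TransGen (M.mutilatedEdge A B) x x := by
  rcases x with e | v
  · intro h
    obtain ⟨c, -, hc⟩ := Relation.TransGen.tail'_iff.1 h
    exact M.not_mutilatedEdge_inl c e hc
  · have key : ∀ y, Relation.TransGen (M.mutilatedEdge A B) (Sum.inr v) y →
        ∃ w, y = Sum.inr w ∧ Relation.TransGen (fun a b => a ∈ M.pa b) v w := by
      intro y hy
      induction hy with
      | @single y hy =>
        rcases y with e | w
        · exact absurd hy (M.not_mutilatedEdge_inl _ _)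
        · exact ⟨w, rfl, .single hy.1⟩
      | @tail y z _ hyz ih =>
        obtain ⟨w, rfl, hw⟩ := ih
        rcases z with e | z
        · exact absurd hyz (M.not_mutilatedEdge_inl _ _)
        · exact ⟨z, rfl, hw.tail hyz.1⟩
    intro h
    obtain ⟨w, hw, hvw⟩ := key _ h
    cases hw
    exact M.acyclic v hvw

theorem reflTransGen_mutilatedEdge_inr_iff {a b : V} :
    Relation.ReflTransGen (M.mutilatedEdge A B) (Sum.inr a) (Sum.inr b) ↔
      Relation.ReflTransGen (fun x y => M.graph.dir x y ∧ y ∉ A ∧ x ∉ B) a b := by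
  constructor
  · intro h
    have key : ∀ y, Relation.ReflTransGen (M.mutilatedEdge A B) (Sum.inr a) y →
        ∃ w, y = Sum.inr w ∧
          Relation.ReflTransGen (fun x y => M.graph.dir x y ∧ y ∉ A ∧ x ∉ B) a w := by
      intro y hy
      induction hy with
      | refl => exact ⟨a, rfl, .refl⟩
      | @tail y z _ hyz ih =>
        obtain ⟨w, rfl, hw⟩ := ih
        rcases z with e | z
        · exact absurd hyz (M.not_mutilatedEdge_inl _ _)
        · exact ⟨z, rfl, hw.tail hyz⟩
    obtain ⟨w, hw, haw⟩ := key _ h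
    cases hw
    exact haw
  · exact fun h => h.lift Sum.inr fun _ _ hxy => hxy

theorem reflTransGen_mutilatedEdge_inl_iff {e : U} {b : V} :
    Relation.ReflTransGen (M.mutilatedEdge A B) (Sum.inl e) (Sum.inr b) ↔
      ∃ s, e ∈ M.exo s ∧ s ∉ A ∧
        Relation.ReflTransGen (fun x y => M.graph.dir x y ∧ y ∉ A ∧ x ∉ B) s b := by
  constructor
  · intro h
    rcases Relation.ReflTransGen.cases_head h with h | ⟨c, hec, hcb⟩
    · cases h
    · rcases c with c | s
      · exact absurd hec (M.not_mutilatedEdge_inl _ _)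
      · exact ⟨s, hec.1, hec.2, M.reflTransGen_mutilatedEdge_inr_iff.1 hcb⟩
  · rintro ⟨s, hes, hsA, hsb⟩
    exact .head (show M.mutilatedEdge A B (Sum.inl e) (Sum.inr s) from ⟨hes, hsA⟩)
      (M.reflTransGen_mutilatedEdge_inr_iff.2 hsb)

end Mutilated

end SCM

section Mediated

variable {V : Type*} {r : V → V → Prop} {Rem X Y Z A B : Set V}

theorem MediatedAdj.reflTransGen (hRA : Disjoint Rem A) (hRB : Disjoint Rem B) {x y : V}
    (h : MediatedAdj r Rem x y) (hx : x ∉ B) (hy : y ∉ A) :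
    Relation.ReflTransGen (fun x y => r x y ∧ y ∉ A ∧ x ∉ B) x y := by
  induction h with
  | edge hab => exact .single ⟨hab, hy, hx⟩
  | cons haq hq _ ih =>
    exact .head ⟨haq, Set.disjoint_left.1 hRA hq, hx⟩ (ih (Set.disjoint_left.1 hRB hq) hy)

theorem mediatedAdj_empty_iff {a b : V} : MediatedAdj r ∅ a b ↔ r a b := by
  constructor
  · rintro (h | ⟨-, h, -⟩)
    · exact h
    · exact h.elim
  · exact .edge

/-- Cutting a directed path into `Y` at its first vertex in `Y` gives a mediated adjacency: the
vertices between its start and that vertex have both an edge in and an edge out, so they lie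
neither in `Z` nor in `X`. -/
theorem exists_mediatedAdj_of_reflTransGen_left (hZA : Z ⊆ A) (hXAB : X ⊆ A ∪ B)
    {v b : V}
    (h : Relation.ReflTransGen (fun x y => r x y ∧ y ∉ A ∧ x ∉ B) v b) (hb : b ∈ Y) :
    v ∈ Y ∨ ∃ b' ∈ Y, MediatedAdj r (X ∪ Y ∪ Z)ᶜ v b' := by
  induction h using Relation.ReflTransGen.head_induction_on with
  | refl => exact Or.inl hb
  | @head v c hvc hcb ih =>
    right
    rcases ih with hc | ⟨b', hb', hcb'⟩
    · exact ⟨c, hc, .edge hvc.1⟩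
    · by_cases hcY : c ∈ Y
      · exact ⟨c, hcY, .edge hvc.1⟩
      refine ⟨b', hb', .cons hvc.1 ?_ hcb'⟩
      rintro ((hcX | hcY') | hcZ)
      · rcases Relation.ReflTransGen.cases_head hcb with rfl | ⟨d, hcd, -⟩
        · exact hcY hb
        · exact (hXAB hcX).elim hvc.2.1 hcd.2.2
      · exact hcY hcY'
      · exact hvc.2.1 (hZA hcZ)

/-- A directed path into `a ∈ X` either avoids `Y` after its start, or the part after its last
vertex in `Y` is a mediated adjacency. -/
theorem mediatedAdj_or_of_reflTransGen_right {v a : V}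
    (h : Relation.ReflTransGen (fun x y => r x y ∧ y ∉ Z ∧ x ∉ X) v a) :
    (∃ b ∈ Y, MediatedAdj r (X ∪ Y ∪ Z)ᶜ b a) ∨ v = a ∨
      (v ∉ X ∧ MediatedAdj r (X ∪ Y ∪ Z)ᶜ v a) := by
  induction h using Relation.ReflTransGen.head_induction_on with
  | refl => exact Or.inr (Or.inl rfl)
  | @head v c hvc _ ih =>
    rcases ih with h | rfl | ⟨hcX, hca⟩
    · exact Or.inl h
    · exact Or.inr (Or.inr ⟨hvc.2.2, .edge hvc.1⟩)
    · by_cases hcY : c ∈ Y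
      · exact Or.inl ⟨c, hcY, hca⟩
      · refine Or.inr (Or.inr ⟨hvc.2.2, .cons hvc.1 ?_ hca⟩)
        rintro ((h | h) | h)
        exacts [hcX h, hcY h, hvc.2.1 h]

end Mediated

namespace SCM

/-! ### Graphical rules for two clusters when all others are intervened on -/

section Rules

variable {V U : Type*} {D : V → Type*} {E : U → Type*}
  [∀ v, MeasurableSpace (D v)] [∀ e, MeasurableSpace (E e)] (M : SCM V U D E) {X Y Z : Set V}

theorem not_mutilatedDSep_iff {A B : Set V} (hZA : Z ⊆ A) (hXZ : Disjoint X Z)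
    (hYZ : Disjoint Y Z) :
    ¬ M.MutilatedDSep A B X Y Z ↔ ∃ t : U ⊕ V, t ∉ Sum.inr '' Z ∧ ∃ a ∈ X, ∃ b ∈ Y,
      Relation.ReflTransGen (M.mutilatedEdge A B) t (Sum.inr a) ∧
      Relation.ReflTransGen (M.mutilatedEdge A B) t (Sum.inr b) := by
  have hS : ∀ x, ∀ s ∈ (Sum.inr '' Z : Set (U ⊕ V)), ¬ M.mutilatedEdge A B x s := by
    rintro (x | x) _ ⟨z, hz, rfl⟩ h
    · exact h.2 (hZA hz)
    · exact h.2.1 (hZA hz)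
  rw [MutilatedDSep, not_dSep_iff_exists_common_ancestor M.mutilatedEdge_acyclic hS
    ((Set.disjoint_image_iff Sum.inr_injective).2 hXZ)
    ((Set.disjoint_image_iff Sum.inr_injective).2 hYZ)]
  simp only [Set.exists_mem_image]

/-- The criterion for an effect of `do(X)` on `Y` under `do(Z)` is a mediated adjacency from `X`
to `Y`: a variable in `X` has no ancestor but itself once the edges into `X` are deleted. -/
theorem not_mutilatedDSep_effect_iff (hXY : Disjoint X Y) (hXZ : Disjoint X Z)
    (hYZ : Disjoint Y Z) :
    ¬ M.MutilatedDSep (X ∪ Z) ∅ X Y Z ↔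
      ∃ a ∈ X, ∃ b ∈ Y, MediatedAdj M.graph.dir (X ∪ Y ∪ Z)ᶜ a b := by
  rw [M.not_mutilatedDSep_iff Set.subset_union_right hXZ hYZ]
  constructor
  · rintro ⟨t, -, a, ha, b, hb, hta, htb⟩
    have hat : Sum.inr a = t := by
      rcases Relation.ReflTransGen.cases_tail hta with h | ⟨c | c, -, hc⟩
      · exact h
      · exact absurd (Or.inl ha) hc.2
      · exact absurd (Or.inl ha) hc.2.1
    subst hat
    rcases exists_mediatedAdj_of_reflTransGen_left (Z := Z) Set.subset_union_right
      (Set.subset_union_left.trans Set.subset_union_left)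
      (M.reflTransGen_mutilatedEdge_inr_iff.1 htb) hb with h | ⟨b', hb', h⟩
    · exact absurd h (Set.disjoint_left.1 hXY ha)
    · exact ⟨a, ha, b', hb', h⟩
  · rintro ⟨a, ha, b, hb, h⟩
    refine ⟨Sum.inr a, ?_, a, ha, b, hb, .refl, M.reflTransGen_mutilatedEdge_inr_iff.2
      (h.reflTransGen ?_ (Set.disjoint_empty _) (Set.notMem_empty _) ?_)⟩
    · rw [Sum.inr_injective.mem_set_image]
      exact Set.disjoint_left.1 hXZ ha
    · exact Set.disjoint_left.2 fun x hx h => hx (h.elim (fun h => .inl (.inl h)) .inr)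
    · exact fun h => h.elim (Set.disjoint_right.1 hXY hb) (Set.disjoint_left.1 hYZ hb)

/-- The criterion for a difference between seeing and doing `X` is confounding of `X` and `Y`
through the remainder, or a mediated adjacency from `Y` back to `X`. The topmost vertex of the
connecting path is an exogenous variable (a confounding path, or a fork if the two children of
that variable on the path coincide), a remainder variable (a fork), or a variable in `Y`. -/
theorem not_mutilatedDSep_seeing_iff (hXY : Disjoint X Y) (hXZ : Disjoint X Z)
    (hYZ : Disjoint Y Z) :
    ¬ M.MutilatedDSep Z X X Y Z ↔
      (∃ a ∈ X, ∃ b ∈ Y, M.graph.ConfPath (X ∪ Y ∪ Z)ᶜ a b ∨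
        M.graph.RemainderFork (X ∪ Y ∪ Z)ᶜ a b) ∨
      ∃ b ∈ Y, ∃ a ∈ X, MediatedAdj M.graph.dir (X ∪ Y ∪ Z)ᶜ b a := by
  rw [M.not_mutilatedDSep_iff subset_rfl hXZ hYZ]
  have hRX : Disjoint (X ∪ Y ∪ Z)ᶜ X := Set.disjoint_left.2 fun x hx h => hx (.inl (.inl h))
  have hRZ : Disjoint (X ∪ Y ∪ Z)ᶜ Z := Set.disjoint_left.2 fun x hx h => hx (.inr h)
  constructor
  · rintro ⟨t | v, ht, a, ha, b, hb, hta, htb⟩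
    · obtain ⟨s, hes, hsZ, hsa⟩ := M.reflTransGen_mutilatedEdge_inl_iff.1 hta
      obtain ⟨w, hew, hwZ, hwb⟩ := M.reflTransGen_mutilatedEdge_inl_iff.1 htb
      have hwX : w ∉ X := by
        intro hwX
        rcases Relation.ReflTransGen.cases_head hwb with rfl | ⟨c, hc, -⟩
        · exact Set.disjoint_left.1 hXY hwX hb
        · exact hc.2.2 hwX
      have hs : (∃ b ∈ Y, MediatedAdj M.graph.dir (X ∪ Y ∪ Z)ᶜ b a) ∨ s = a ∨
          (s ∈ (X ∪ Y ∪ Z)ᶜ ∧ MediatedAdj M.graph.dir (X ∪ Y ∪ Z)ᶜ s a) := by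
        rcases mediatedAdj_or_of_reflTransGen_right (Y := Y) hsa with h | h | ⟨hsX, h⟩
        · exact Or.inl h
        · exact Or.inr (Or.inl h)
        · by_cases hsY : s ∈ Y
          · exact Or.inl ⟨s, hsY, h⟩
          · refine Or.inr (Or.inr ⟨?_, h⟩)
            rintro ((h | h) | h)
            exacts [hsX h, hsY h, hsZ h]
      have hw : ∃ b ∈ Y, w = b ∨
          (w ∈ (X ∪ Y ∪ Z)ᶜ ∧ MediatedAdj M.graph.dir (X ∪ Y ∪ Z)ᶜ w b) := by
        by_cases hwY : w ∈ Y
        · exact ⟨w, hwY, Or.inl rfl⟩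
        rcases exists_mediatedAdj_of_reflTransGen_left (X := X) subset_rfl
          Set.subset_union_right hwb hb with h | ⟨b', hb', h⟩
        · exact absurd h hwY
        · refine ⟨b', hb', Or.inr ⟨?_, h⟩⟩
          rintro ((h | h) | h)
          exacts [hwX h, hwY h, hwZ h]
      rcases hs with ⟨b, hb, h⟩ | hs
      · exact Or.inr ⟨b, hb, a, ha, h⟩
      obtain ⟨b', hb', hw⟩ := hw
      refine Or.inl ⟨a, ha, b', hb', ?_⟩
      by_cases hsw : s = w
      · subst hsw
        right
        rcases hs with rfl | ⟨hsR, hsa⟩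
        · exact absurd ha hwX
        · rcases hw with rfl | ⟨-, hwb⟩
          · exact absurd (Or.inl (Or.inr hb')) hsR
          · exact ⟨s, hsR, hsa, hwb⟩
      · exact Or.inl ⟨s, w, ⟨hsw, t, hes, hew⟩, hs, hw⟩
    · rw [Sum.inr_injective.mem_set_image] at ht
      have hvb := M.reflTransGen_mutilatedEdge_inr_iff.1 htb
      have hvX : v ∉ X := by
        intro hvX
        rcases Relation.ReflTransGen.cases_head hvb with rfl | ⟨c, hc, -⟩
        · exact Set.disjoint_left.1 hXY hvX hb
        · exact hc.2.2 hvX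
      rcases mediatedAdj_or_of_reflTransGen_right (Y := Y)
        (M.reflTransGen_mutilatedEdge_inr_iff.1 hta) with ⟨b', hb', h⟩ | rfl | ⟨-, hva⟩
      · exact Or.inr ⟨b', hb', a, ha, h⟩
      · exact absurd ha hvX
      by_cases hvY : v ∈ Y
      · exact Or.inr ⟨v, hvY, a, ha, hva⟩
      rcases exists_mediatedAdj_of_reflTransGen_left (X := X) subset_rfl
        Set.subset_union_right hvb hb with h | ⟨b', hb', h⟩
      · exact absurd h hvY
      · refine Or.inl ⟨a, ha, b', hb', Or.inr ⟨v, ?_, hva, h⟩⟩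
        rintro ((h | h) | h)
        exacts [hvX h, hvY h, ht h]
  · rintro (⟨a, ha, b, hb, ⟨s, w, ⟨-, e, hes, hew⟩, hs, hw⟩ | ⟨q, hq, hqa, hqb⟩⟩ |
      ⟨b, hb, a, ha, hba⟩)
    · have haZ := Set.disjoint_left.1 hXZ ha
      have hbZ := Set.disjoint_left.1 hYZ hb
      refine ⟨Sum.inl e, by simp, a, ha, b, hb, M.reflTransGen_mutilatedEdge_inl_iff.2 ?_,
        M.reflTransGen_mutilatedEdge_inl_iff.2 ?_⟩
      · rcases hs with rfl | ⟨hsR, hsa⟩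
        · exact ⟨s, hes, haZ, .refl⟩
        · exact ⟨s, hes, Set.disjoint_left.1 hRZ hsR,
            hsa.reflTransGen hRZ hRX (Set.disjoint_left.1 hRX hsR) haZ⟩
      · rcases hw with rfl | ⟨hwR, hwb⟩
        · exact ⟨w, hew, hbZ, .refl⟩
        · exact ⟨w, hew, Set.disjoint_left.1 hRZ hwR,
            hwb.reflTransGen hRZ hRX (Set.disjoint_left.1 hRX hwR) hbZ⟩
    · have hqX := Set.disjoint_left.1 hRX hq
      refine ⟨Sum.inr q, ?_, a, ha, b, hb,
        M.reflTransGen_mutilatedEdge_inr_iff.2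
          (hqa.reflTransGen hRZ hRX hqX (Set.disjoint_left.1 hXZ ha)),
        M.reflTransGen_mutilatedEdge_inr_iff.2
          (hqb.reflTransGen hRZ hRX hqX (Set.disjoint_left.1 hYZ hb))⟩
      rw [Sum.inr_injective.mem_set_image]
      exact Set.disjoint_left.1 hRZ hq
    · refine ⟨Sum.inr b, ?_, a, ha, b, hb, M.reflTransGen_mutilatedEdge_inr_iff.2
        (hba.reflTransGen hRZ hRX (Set.disjoint_right.1 hXY hb) (Set.disjoint_left.1 hXZ ha)),
        .refl⟩
      rw [Sum.inr_injective.mem_set_image]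
      exact Set.disjoint_left.1 hYZ hb

end Rules

end SCM

theorem CausalGraph.confPath_empty_iff {V : Type*} (G : CausalGraph V) {a b : V} :
    G.ConfPath ∅ a b ↔ G.conf a b := by
  constructor
  · rintro ⟨s, t, hst, rfl | ⟨h, -⟩, rfl | ⟨h', -⟩⟩
    exacts [hst, h'.elim, h.elim, h.elim]
  · exact fun h => ⟨a, b, h, .inl rfl, .inl rfl⟩

theorem CausalGraph.not_remainderFork_empty {V : Type*} (G : CausalGraph V) {a b : V} :
    ¬ G.RemainderFork ∅ a b :=
  fun ⟨_, h, _⟩ => h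

/-! ### Measurability and existence of solutions -/

namespace SCM

section Solve

variable {V U : Type*} {D : V → Type*} {E : U → Type*}
  [∀ v, MeasurableSpace (D v)] [∀ e, MeasurableSpace (E e)] [Finite V] (M : SCM V U D E)

theorem measurable_solve (Z : Set V) :
    Measurable fun q : (∀ v, D v) × (∀ e, E e) => M.solve Z q.1 q.2 := by
  classical
  refine measurable_pi_lambda _ fun v => ?_
  induction v using M.wellFounded_pa.induction with
  | _ v ih =>
    simp_rw [M.solve_eq Z _ _ v]
    by_cases hv : v ∈ Z
    · simp only [if_pos hv]
      fun_prop
    · simp only [if_neg hv]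
      refine (M.measurable_mech v).comp (Measurable.prodMk ?_ ?_)
      · exact measurable_pi_lambda _ fun p => ih p.1 p.2
      · fun_prop

theorem measurable_solve_right (Z : Set V) (a : ∀ v, D v) : Measurable (M.solve Z a) :=
  (M.measurable_solve Z).comp measurable_prodMk_left

/-- The mechanisms compute a value of every variable from any value of the exogenous ones. -/
theorem nonempty_ranges (M : SCM V U D E) : Nonempty (∀ v, D v) := by
  have := M.isProbabilityMeasure_prob
  obtain ⟨u⟩ := nonempty_of_isProbabilityMeasure M.prob
  refine ⟨M.wellFounded_pa.fix fun v rec => M.mech v (fun p => rec p.1 p.2) fun e => u e.1⟩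

theorem measurable_doDist (Z Y : Set V) {B : Set (∀ v : Y, D v)} (hB : MeasurableSet B) :
    Measurable fun a => M.doDist Z a Y B := by
  have := M.isProbabilityMeasure_prob
  have hY : Measurable (Y.domRestrict (π := D)) :=
    measurable_pi_lambda _ fun v => measurable_pi_apply v.1
  have hset := (hY.comp (M.measurable_solve Z)) hB
  convert measurable_measure_prodMk_left (ν := M.prob) hset using 2 with a
  rw [doDist, doLaw, Measure.map_map hY (M.measurable_solve_right Z a),
    Measure.map_apply (hY.comp (M.measurable_solve_right Z a)) hB]
  rfl

end Solve

end SCM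

/-! ### Transfer of causal relations along an abstraction -/

theorem measurable_domRestrict {ι : Type*} {π : ι → Type*} [∀ i, MeasurableSpace (π i)]
    (Y : Set ι) : Measurable (Y.domRestrict (π := π)) :=
  measurable_pi_lambda _ fun i => measurable_pi_apply i.1

section VarPreimage

variable {V C : Type*} {R : Set V} (φ : R → C)

theorem varPreimage_union (X Y : Set C) :
    varPreimage φ (X ∪ Y) = varPreimage φ X ∪ varPreimage φ Y := by
  ext v
  simp [varPreimage, exists_or]

theorem disjoint_varPreimage {X Y : Set C} (h : Disjoint X Y) :
    Disjoint (varPreimage φ X) (varPreimage φ Y) :=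
  Set.disjoint_left.2 fun _ ⟨_, hX⟩ ⟨_, hY⟩ => Set.disjoint_left.1 h hX hY

theorem varPreimage_univ : varPreimage φ Set.univ = R := by
  ext v
  simp [varPreimage]

theorem exists_mem_varPreimage_singleton {c : C} {p : V → Prop} :
    (∃ v ∈ varPreimage φ {c}, p v) ↔ ∃ a : R, φ a = c ∧ p a :=
  ⟨fun ⟨v, ⟨hv, hc⟩, hp⟩ => ⟨⟨v, hv⟩, hc, hp⟩, fun ⟨a, hc, hp⟩ => ⟨a, ⟨a.2, hc⟩, hp⟩⟩

end VarPreimage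

namespace AlphaAbstraction

variable {V C : Type*} {D : V → Type*} {D' : C → Type*}
  [∀ v, MeasurableSpace (D v)] [∀ c, MeasurableSpace (D' c)] (α : AlphaAbstraction D D')

theorem measurable_mapOn (Y : Set C) : Measurable (α.mapOn Y) :=
  measurable_pi_lambda _ fun c => (α.val_measurable c).comp <|
    measurable_pi_lambda _ fun _ => measurable_pi_apply _

theorem measurable_mapAll : Measurable α.mapAll :=
  measurable_pi_lambda _ fun c => (α.val_measurable c).comp <|
    measurable_pi_lambda _ fun _ => measurable_pi_apply _

variable {α}

theorem IsBijective.injective_mapOn (hbij : α.IsBijective) (Y : Set C) :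
    Function.Injective (α.mapOn Y) := by
  intro w w' h
  ext ⟨v, hv⟩
  have hc := congrFun h ⟨α.φ ⟨v, hv.1⟩, hv.2⟩
  exact congrFun ((hbij _).1 hc) ⟨v, ⟨hv.1, rfl⟩⟩

/-- By the Lusin–Souslin theorem. -/
theorem IsBijective.measurableEmbedding_mapOn [Finite V] [Finite C]
    [∀ v, StandardBorelSpace (D v)] [∀ c, StandardBorelSpace (D' c)]
    (hbij : α.IsBijective) (Y : Set C) : MeasurableEmbedding (α.mapOn Y) :=
  (α.measurable_mapOn Y).measurableEmbedding (hbij.injective_mapOn Y)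

variable (α) in
theorem surjective_mapAll [Nonempty (∀ v, D v)] : Function.Surjective α.mapAll := by
  classical
  intro a'
  obtain ⟨a₀⟩ := ‹Nonempty (∀ v, D v)›
  choose w hw using fun c => α.val_surjective c (a' c)
  refine ⟨fun v => if h : v ∈ α.R then w (α.φ ⟨v, h⟩) ⟨v, h, rfl⟩ else a₀ v, ?_⟩
  funext c
  rw [← hw c]
  refine congrArg (α.val c) ?_
  funext ⟨v, hv, hc⟩
  have hc : α.φ ⟨v, hv⟩ = c := hc
  subst hc
  simp [hv]

variable {U U' : Type*} {E : U → Type*} {E' : U' → Type*}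
  [∀ e, MeasurableSpace (E e)] [∀ e, MeasurableSpace (E' e)] [Finite V] [Finite C]
  {M : SCM V U D E} {M' : SCM C U' D' E'}

/-- Consistency for all abstract variables at once, as an equation between joint laws. -/
theorem IsL2Consistent.doLaw_mapAll (hcons : α.IsL2Consistent M M') (X : Set C)
    (a : ∀ v, D v) :
    M'.doLaw X (α.mapAll a) = (M.doLaw (varPreimage α.φ X) a).map α.mapAll := by
  have h := hcons X Set.univ a
  simp only [SCM.doDist] at h
  rw [Measure.map_map (α.measurable_mapOn _) (measurable_domRestrict _)] at h
  have hcomp : α.mapOn Set.univ ∘ (varPreimage α.φ Set.univ).domRestrict (π := D) =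
      (Set.univ : Set C).domRestrict (π := D') ∘ α.mapAll := rfl
  rw [hcomp, ← Measure.map_map (measurable_domRestrict _) α.measurable_mapAll] at h
  let ext : (∀ c : (Set.univ : Set C), D' c) → ∀ c, D' c := fun w c => w ⟨c, trivial⟩
  have hext : Measurable ext := measurable_pi_lambda _ fun c => measurable_pi_apply _
  have h := congrArg (Measure.map ext) h
  have hid : ext ∘ (Set.univ : Set C).domRestrict (π := D') = id := rfl
  rwa [Measure.map_map hext (measurable_domRestrict _),
    Measure.map_map hext (measurable_domRestrict _), hid, Measure.map_id, Measure.map_id] at h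

variable [∀ v, StandardBorelSpace (D v)] [∀ c, StandardBorelSpace (D' c)]

theorem IsL2Consistent.noEffect_iff (hcons : α.IsL2Consistent M M') (hbij : α.IsBijective)
    (X Y Z : Set C) :
    M'.NoEffect X Y Z ↔
      M.NoEffect (varPreimage α.φ X) (varPreimage α.φ Y) (varPreimage α.φ Z) := by
  have := M.nonempty_ranges
  rw [SCM.NoEffect, α.surjective_mapAll.forall]
  refine forall_congr' fun a => ?_
  rw [hcons, hcons, varPreimage_union]
  constructor
  · intro h
    ext s hs
    have hemb := hbij.measurableEmbedding_mapOn Y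
    have := congrArg (fun μ => μ (α.mapOn Y '' s)) h
    simpa only [hemb.map_apply, hemb.injective.preimage_image] using this
  · intro h
    rw [h]

/-- The integrals over the interventional laws are related by the change of variables `mapAll`; this
map need not be injective, as it forgets the remainder variables, but the integrand depends only on
its value. -/
theorem IsL2Consistent.seeingEqDoing_iff (hcons : α.IsL2Consistent M M')
    (hbij : α.IsBijective) (X Y Z : Set C) :
    M'.SeeingEqDoing X Y Z ↔
      M.SeeingEqDoing (varPreimage α.φ X) (varPreimage α.φ Y) (varPreimage α.φ Z) := by
  have := M.nonempty_ranges
  -- An abstract event and its pre-image are related by the same equation in both models.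
  have key : ∀ (a : ∀ v, D v) (A : Set (∀ c : X, D' c)) (B : Set (∀ c : Y, D' c)),
      MeasurableSet A → MeasurableSet B →
      (M'.doLaw Z (α.mapAll a) (X.domRestrict ⁻¹' A ∩ Y.domRestrict ⁻¹' B) =
        ∫⁻ w in X.domRestrict ⁻¹' A, M'.doDist (X ∪ Z) w Y B ∂(M'.doLaw Z (α.mapAll a)) ↔
      M.doLaw (varPreimage α.φ Z) a
          ((varPreimage α.φ X).domRestrict ⁻¹' (α.mapOn X ⁻¹' A) ∩
            (varPreimage α.φ Y).domRestrict ⁻¹' (α.mapOn Y ⁻¹' B)) =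
        ∫⁻ w in (varPreimage α.φ X).domRestrict ⁻¹' (α.mapOn X ⁻¹' A),
          M.doDist (varPreimage α.φ X ∪ varPreimage α.φ Z) w (varPreimage α.φ Y)
            (α.mapOn Y ⁻¹' B) ∂(M.doLaw (varPreimage α.φ Z) a)) := by
    intro a A B hA hB
    have hXA := measurable_domRestrict X hA
    have hYB := measurable_domRestrict Y hB
    rw [hcons.doLaw_mapAll, Measure.map_apply α.measurable_mapAll (hXA.inter hYB),
      setLIntegral_map hXA (M'.measurable_doDist _ _ hB) α.measurable_mapAll]
    simp_rw [hcons (X ∪ Z) Y, Measure.map_apply (α.measurable_mapOn Y) hB, varPreimage_union]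
    rfl
  have hX := hbij.measurableEmbedding_mapOn X
  have hY := hbij.measurableEmbedding_mapOn Y
  rw [SCM.SeeingEqDoing, α.surjective_mapAll.forall]
  refine forall_congr' fun a => ⟨fun h A B hA hB => ?_, fun h A B hA hB => ?_⟩
  · have := (key a _ _ (hX.measurableSet_image.2 hA) (hY.measurableSet_image.2 hB)).1
      (h _ _ (hX.measurableSet_image.2 hA) (hY.measurableSet_image.2 hB))
    simpa only [hX.injective.preimage_image, hY.injective.preimage_image] using this
  · exact (key a A B hA hB).2 (h _ _ (hX.measurable hA) (hY.measurable hB))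

end AlphaAbstraction

/-! ### Reading off the edges of faithful models -/

theorem Set.compl_pair_union_compl {ι : Type*} (i j : ι) :
    ({i} ∪ {j} ∪ {i, j}ᶜ : Set ι)ᶜ = ∅ := by
  rw [Set.singleton_union, Set.union_compl_self, Set.compl_univ]

namespace SCM

variable {V U : Type*} {D : V → Type*} {E : U → Type*}
  [∀ v, MeasurableSpace (D v)] [∀ e, MeasurableSpace (E e)] [Finite V] {M : SCM V U D E}

section Clusters

variable {X Y Z : Set V}

theorem IsFaithful.not_noEffect_iff (hM : M.IsFaithful) (hXY : Disjoint X Y)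
    (hXZ : Disjoint X Z) (hYZ : Disjoint Y Z) :
    ¬ M.NoEffect X Y Z ↔ ∃ a ∈ X, ∃ b ∈ Y, MediatedAdj M.graph.dir (X ∪ Y ∪ Z)ᶜ a b := by
  rw [hM.effect_iff X Y Z hXY hXZ hYZ, M.not_mutilatedDSep_effect_iff hXY hXZ hYZ]

theorem IsFaithful.not_seeingEqDoing_iff (hM : M.IsFaithful) (hXY : Disjoint X Y)
    (hXZ : Disjoint X Z) (hYZ : Disjoint Y Z) :
    ¬ M.SeeingEqDoing X Y Z ↔
      (∃ a ∈ X, ∃ b ∈ Y, M.graph.ConfPath (X ∪ Y ∪ Z)ᶜ a b ∨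
        M.graph.RemainderFork (X ∪ Y ∪ Z)ᶜ a b) ∨
      ∃ b ∈ Y, ∃ a ∈ X, MediatedAdj M.graph.dir (X ∪ Y ∪ Z)ᶜ b a := by
  rw [hM.seeing_iff X Y Z hXY hXZ hYZ, M.not_mutilatedDSep_seeing_iff hXY hXZ hYZ]

end Clusters

theorem IsFaithful.dir_iff_not_noEffect (hM : M.IsFaithful) {i j : V} (hij : i ≠ j) :
    M.graph.dir i j ↔ ¬ M.NoEffect {i} {j} {i, j}ᶜ := by
  rw [hM.not_noEffect_iff (by simpa) (by simp) (by simp),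
    Set.compl_pair_union_compl]
  simp [mediatedAdj_empty_iff]

theorem IsFaithful.not_seeingEqDoing_singleton_iff (hM : M.IsFaithful) {i j : V}
    (hij : i ≠ j) :
    ¬ M.SeeingEqDoing {i} {j} {i, j}ᶜ ↔ M.graph.conf i j ∨ M.graph.dir j i := by
  rw [hM.not_seeingEqDoing_iff (by simpa) (by simp) (by simp),
    Set.compl_pair_union_compl]
  simp [mediatedAdj_empty_iff, CausalGraph.confPath_empty_iff,
    CausalGraph.not_remainderFork_empty]

end SCM

theorem mainTheorem2 {V V' U U' : Type*} [Finite V] [Finite V']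
    {D : V → Type*} {D' : V' → Type*} {E : U → Type*} {E' : U' → Type*}
    [∀ v, MeasurableSpace (D v)] [∀ v, StandardBorelSpace (D v)]
    [∀ c, MeasurableSpace (D' c)] [∀ c, StandardBorelSpace (D' c)]
    [∀ e, MeasurableSpace (E e)] [∀ e, MeasurableSpace (E' e)]
    (M : SCM V U D E) (M' : SCM V' U' D' E')
    (hM : M.IsFaithful) (hM' : M'.IsFaithful)
    (α : AlphaAbstraction D D') (hbij : α.IsBijective) (hcons : α.IsL2Consistent M M') :
    M.graph.IsPartialClusterDAG α.R α.φ M'.graph := by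
  have hrem : ∀ i j : V', (varPreimage α.φ {i} ∪ varPreimage α.φ {j} ∪
      varPreimage α.φ {i, j}ᶜ)ᶜ = α.Rᶜ := by
    intro i j
    rw [← varPreimage_union, ← varPreimage_union, Set.singleton_union, Set.union_compl_self,
      varPreimage_univ]
  have hdisj : ∀ {i j : V'}, i ≠ j → Disjoint (varPreimage α.φ {i}) (varPreimage α.φ {j}) :=
    fun hij => disjoint_varPreimage _ (by simpa)
  have hdisj₁ : ∀ i j : V', Disjoint (varPreimage α.φ {i}) (varPreimage α.φ {i, j}ᶜ) :=
    fun i j => disjoint_varPreimage _ (by simp)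
  have hdisj₂ : ∀ i j : V', Disjoint (varPreimage α.φ {j}) (varPreimage α.φ {i, j}ᶜ) :=
    fun i j => disjoint_varPreimage _ (by simp)
  have hdir : ∀ {i j : V'}, i ≠ j → (M'.graph.dir i j ↔
      ∃ a : α.R, α.φ a = i ∧ ∃ b : α.R, α.φ b = j ∧ MediatedAdj M.graph.dir α.Rᶜ a b) := by
    intro i j hij
    rw [hM'.dir_iff_not_noEffect hij, hcons.noEffect_iff hbij,
      hM.not_noEffect_iff (hdisj hij) (hdisj₁ i j) (hdisj₂ i j), hrem]
    simp only [exists_mem_varPreimage_singleton]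
  have hasymm : ∀ i j, M'.graph.dir i j → ¬ M'.graph.dir j i :=
    fun i j h h' => M'.acyclic i (.head h (.single h'))
  have hseeing : ∀ {i j : V'}, i ≠ j → ((M'.graph.conf i j ∨ M'.graph.dir j i) ↔
      (∃ a : α.R, α.φ a = i ∧ ∃ b : α.R, α.φ b = j ∧
        (M.graph.ConfPath α.Rᶜ a b ∨ M.graph.RemainderFork α.Rᶜ a b)) ∨
      M'.graph.dir j i) := by
    intro i j hij
    rw [← hM'.not_seeingEqDoing_singleton_iff hij, hcons.seeingEqDoing_iff hbij,
      hM.not_seeingEqDoing_iff (hdisj hij) (hdisj₁ i j) (hdisj₂ i j), hrem, hdir hij.symm]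
    simp only [exists_mem_varPreimage_singleton]
  -- `hseeing` is inconclusive if `j → i`; it is then applied to the pair `(j, i)`, for which it is
  -- conclusive by acyclicity, and both sides of the confounding rule are symmetric.
  have hconf_symm : ∀ i j, M'.graph.conf i j → M'.graph.conf j i :=
    fun i j ⟨hne, e, hi, hj⟩ => ⟨hne.symm, e, hj, hi⟩
  have hpath_symm : ∀ a b, M.graph.ConfPath α.Rᶜ a b ∨ M.graph.RemainderFork α.Rᶜ a b →
      M.graph.ConfPath α.Rᶜ b a ∨ M.graph.RemainderFork α.Rᶜ b a := by
    rintro a b (⟨s, t, ⟨hne, e, hs, ht⟩, hsa, htb⟩ | ⟨q, hq, hqa, hqb⟩)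
    · exact Or.inl ⟨t, s, ⟨hne.symm, e, ht, hs⟩, htb, hsa⟩
    · exact Or.inr ⟨q, hq, hqb, hqa⟩
  refine ⟨α.φ_surjective, fun i j => ?_, fun i j => ?_, M'.acyclic⟩
  · constructor
    · intro h
      have hij : i ≠ j := fun hij => M'.acyclic i (.single (hij ▸ h))
      obtain ⟨a, ha, b, hb, hab⟩ := (hdir hij).1 h
      exact ⟨hij, a, b, ha, hb, hab⟩
    · rintro ⟨hij, a, b, ha, hb, hab⟩
      exact (hdir hij).2 ⟨a, ha, b, hb, hab⟩
  · constructor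
    · intro h
      have hij : i ≠ j := h.1
      refine ⟨hij, ?_⟩
      by_cases hji : M'.graph.dir j i
      · rcases (hseeing hij.symm).1 (Or.inl (hconf_symm _ _ h)) with ⟨b, hb, a, ha, hba⟩ | h'
        · exact ⟨a, b, ha, hb, hpath_symm _ _ hba⟩
        · exact absurd h' (hasymm _ _ hji)
      · rcases (hseeing hij).1 (Or.inl h) with ⟨a, ha, b, hb, hab⟩ | h'
        · exact ⟨a, b, ha, hb, hab⟩
        · exact absurd h' hji
    · rintro ⟨hij, a, b, ha, hb, hab⟩
      by_cases hji : M'.graph.dir j i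
      · rcases (hseeing hij.symm).2 (Or.inl ⟨b, hb, a, ha, hpath_symm _ _ hab⟩) with h | h
        · exact hconf_symm _ _ h
        · exact absurd h (hasymm _ _ hji)
      · exact ((hseeing hij).2 (Or.inl ⟨a, ha, b, hb, hab⟩)).resolve_right hji
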